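/- Let $n,p\ge 1$ be integers, $\epsilon,\beta\in(0,1)$, $\lambda\in(0,1-\beta]$, $\sigma>0$ and $\theta^*\in\mathbb{R}^p$. For $x^n=(x_1,\dots,x_n)\in(\mathbb{R}^p)^n$, $y^n\in\mathbb{R}^n$ and $\theta\in\mathbb{R}^p$ let $$p_\theta(y^n|x^n)=\prod_{i=1}^n N(y_i\,|\,x_i^T\theta,\sigma^2),\qquad p_*=p_{\theta^*},$$ where $N(\cdot|m,v)$ is the Gaussian density with mean $m$ and (co)variance $v$. Let $$\mathcal{P}^n_x=\Big\{\prod_{i=1}^n N(x_i|0,\Sigma)\ :\ \Sigma \text{ a non-singular } p\times p \text{ covariance matrix}\Big\}$$ and, for the element $q_*$ of $\mathcal{P}^n_x$ with covariance $\Sigma$, let $$A^n_\epsilon=\Big\{x^n\ :\ \forall j\in\{1,\dots,p\},\ 1-\epsilon\le \frac{(1/n)\sum_{i=1}^n x_{ij}^2}{\Sigma_{jj}}\le 1+\epsilon\Big\}.$$ Let $d^n_\lambda(p_*,p_\theta)=-\frac{1}{1-\lambda}\log E_{q_*(x^n)p_*(y^n|x^n)}\big[\big(p_\theta(y^n|x^n)/p_*(y^n|x^n)\big)^{1-\lambda}\big]$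 be the Rényi divergence of order $\lambda$, and let $\|\theta\|_{w,1}=\sum_{j=1}^p w_j|\theta_j|$ with $w_j=\sqrt{\frac1n\sum_{i=1}^n x_{ij}^2}$. If $$\mu_1\ge\sqrt{\frac{n\log 4p}{\beta\sigma^2(1-\epsilon)}\cdot\frac{\lambda+8\sqrt{1-\epsilon^2}}{4}}\qquad\text{and}\qquad \mu_2\ge\frac{\log 2}{\beta},$$ then the penalty $L_1(\theta|x^n)=\mu_1\|\theta\|_{w,1}+\mu_2$ is $\epsilon$-risk valid for $(\lambda,\beta,\mathcal{P}^n_x,A^n_\epsilon)$. That is, for every $q_*\in\mathcal{P}^n_x$ there exist a subset $\widetilde\Theta(q_*)\subset\mathbb{R}^p$ and a function $\tilde L(\cdot|q_*)$ on it with $\sum_{\tilde\theta\in\widetilde\Theta(q_*)}\exp(-\beta\tilde L(\tilde\theta|q_*))\le 1$ such that, for all $x^n\in A^n_\epsilon$ and all $y^n\in\mathbb{R}^n$, $$\max_{\theta\in\mathbb{R}^p}\Big\{d^n_\lambda(p_*,p_\theta)-\log\frac{p_*(y^n|x^n)}{p_\theta(y^n|x^n)}-L_1(\theta|x^n)\Big\}\le\max_{\tilde\theta\in\widetilde\Theta(q_*)}\Big\{d^n_\lambda(p_*,p_{\tilde\theta})-\log\frac{p_*(y^n|x^n)}{p_{\tilde\theta}(y^n|x^n)}-\tilde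 L(\tilde\theta|q_*)\Big\},$$ where both maxima are attained. -/

import Mathlib

open MeasureTheory ProbabilityTheory
open scoped ENNReal NNReal

noncomputable section

namespace RandomDesign

/-! ### Random design: Rényi divergence, strong Kraft inequality, `ε`-risk validity

The law of the covariates `xⁿ = (x_1, …, x_n) ∈ 𝒳ⁿ` is a measure `q`; a conditional model for
`yⁿ ∈ 𝒴ⁿ` given `xⁿ` is a conditional density `p : 𝒳ⁿ → 𝒴ⁿ → ℝ` with respect to the reference
measure on `𝒴ⁿ`, with `p x y` standing for `p(yⁿ | xⁿ)`. -/

section General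

variable {X Y : Type*} [MeasurableSpace X] [MeasureSpace Y] {n : ℕ}

/-- The joint law `q(xⁿ) p(yⁿ | xⁿ) dxⁿ dyⁿ`. -/
def jointLaw (q : Measure (Fin n → X)) (p : (Fin n → X) → (Fin n → Y) → ℝ) :
    Measure ((Fin n → X) × (Fin n → Y)) :=
  (q.prod volume).withDensity fun z => ENNReal.ofReal (p z.1 z.2)

/-- The Rényi divergence of order `lam ∈ (0, 1)` with random design,
`d^n_lam(p, r) = - (1 - lam)⁻¹ log E_{q p} [(r(yⁿ|xⁿ) / p(yⁿ|xⁿ)) ^ (1 - lam)]`. -/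
def renyiDiv (lam : ℝ) (q : Measure (Fin n → X)) (p r : (Fin n → X) → (Fin n → Y) → ℝ) : ℝ :=
  -(1 / (1 - lam)) *
    Real.log (∫ z, (r z.1 z.2 / p z.1 z.2) ^ (1 - lam) ∂(jointLaw q p))

/-- The `β`-stronger Kraft inequality for a codelength `h` on a set `T` of parameters. The sum is
taken in `[0, ∞]`, so that the inequality includes convergence (and countability of `T`). -/
def StrongKraft {Θ : Type*} (β : ℝ) (T : Set Θ) (h : Θ → ℝ) : Prop :=
  ∑' t : T, ENNReal.ofReal (Real.exp (-(β * h t))) ≤ 1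

/-- The quantity `d^n_lam(p_*, p_θ) - log (p_*(yⁿ|xⁿ) / p_θ(yⁿ|xⁿ)) - ℓ`, where `ℓ` is the value
of a penalty or of a codelength. -/
def penalizedExcess (lam : ℝ) (q : Measure (Fin n → X)) (pstar pθ : (Fin n → X) → (Fin n → Y) → ℝ)
    (ℓ : ℝ) (x : Fin n → X) (y : Fin n → Y) : ℝ :=
  renyiDiv lam q pstar pθ - Real.log (pstar x y / pθ x y) - ℓ

/-- `ε`-risk validity of the penalty `L(θ | xⁿ)` for the class `{q k | k : K}` of covariate laws
and the typical sets `A k` attached to them: for every law `q k` there are a quantized subset `T`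
of the parameter space and a codelength `Lq` on it, both allowed to depend on the law but not on
the data, such that `Lq` satisfies the `β`-stronger Kraft inequality on `T` and, for all `x ∈ A k`
and all `y`, the maximum over all parameters of the excess penalized by `L` is at most the maximum
over `T` of the excess penalized by `Lq`. Both maxima are required to exist. -/
def IsEpsRiskValid {Θ K : Type*} (lam β : ℝ) (q : K → Measure (Fin n → X))
    (A : K → Set (Fin n → X)) (pstar : (Fin n → X) → (Fin n → Y) → ℝ)
    (model : Θ → (Fin n → X) → (Fin n → Y) → ℝ) (L : Θ → (Fin n → X) → ℝ) : Prop :=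
  ∀ k : K, ∃ (T : Set Θ) (Lq : Θ → ℝ), StrongKraft β T Lq ∧
    ∀ x ∈ A k, ∀ y : Fin n → Y, ∃ a b : ℝ,
      IsGreatest (Set.range fun θ => penalizedExcess lam (q k) pstar (model θ) (L θ x) x y) a ∧
      IsGreatest ((fun θ => penalizedExcess lam (q k) pstar (model θ) (Lq θ) x y) '' T) b ∧
      a ≤ b

end General

/-! ### Gaussian linear regression and the column-weighted `ℓ¹` penalty -/

/-- The law `∏_{i=1}^n N(x_i | 0, S)` of `n` independent centred Gaussian covariate vectors. -/
def gaussianDesign (n p : ℕ) (S : Matrix (Fin p) (Fin p) ℝ) :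
    Measure (Fin n → EuclideanSpace ℝ (Fin p)) :=
  Measure.pi fun _ => multivariateGaussian 0 S

/-- The conditional density `∏_{i=1}^n N(y_i | x_iᵀ θ, σ²)` of linear regression. -/
def linRegDensity {n p : ℕ} (σ : ℝ) (θ : EuclideanSpace ℝ (Fin p))
    (x : Fin n → EuclideanSpace ℝ (Fin p)) (y : Fin n → ℝ) : ℝ :=
  ∏ i, gaussianPDFReal (inner ℝ (x i) θ) (Real.toNNReal (σ ^ 2)) (y i)

/-- The empirical second moment `(1/n) ∑_i x_{ij}²` of column `j` of the design. -/
def colMoment {n p : ℕ} (x : Fin n → EuclideanSpace ℝ (Fin p)) (j : Fin p) : ℝ :=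
  (1 / (n : ℝ)) * ∑ i, (x i j) ^ 2

/-- The designs with `1 - ε ≤ ((1/n) ∑_i x_{ij}²) / S_jj ≤ 1 + ε` for every column `j`. -/
def typicalSet (n p : ℕ) (ε : ℝ) (S : Matrix (Fin p) (Fin p) ℝ) :
    Set (Fin n → EuclideanSpace ℝ (Fin p)) :=
  {x | ∀ j, 1 - ε ≤ colMoment x j / S j j ∧ colMoment x j / S j j ≤ 1 + ε}

/-- The weighted norm `‖θ‖_{w,1} = ∑_j w_j |θ_j|` with `w_j = √((1/n) ∑_i x_{ij}²)`. -/
def weightedL1 {n p : ℕ} (x : Fin n → EuclideanSpace ℝ (Fin p))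
    (θ : EuclideanSpace ℝ (Fin p)) : ℝ :=
  ∑ j, Real.sqrt (colMoment x j) * |θ j|

end RandomDesign

end

/-!
Write `d(θ)` for the Rényi divergence, `A = S^{1/2}` and `ℓ(θ) = log (p_θ / p_*)`. Gaussian integrals
give `d(θ) = n / (2 (1 - lam)) * log (1 + lam (1 - lam) / σ² * ‖A (θ - θ_*)‖²)`
(`renyiDiv_linReg`), while `ℓ` is a concave quadratic (`log_linRegDensity_div`). Since
`log (1 + r²) + r² / 8` is convex, `d(θ) + n lam / (16 σ²) ‖A θ‖²` is convex, so `d + ℓ` is convex up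
to an explicit quadratic form (`excess_combo_le`).

The quantized parameters form the grid with mesh `δ / √S_jj` in direction `j`, and the codelength is
`(log (4 p) ∑_j |u_j| + log 2) / β` at the grid point with integer coordinates `u`; a geometric series
gives the Kraft inequality (`strongKraft_grid`). Any `θ` is rounded to the grid one coordinate at a
time. If the coordinate is rounded at random to one of its two neighbours so as to keep its mean, the
mean of the codelength is unchanged, and `d + ℓ` loses at most its curvature times a variance that
is linear in `|θ_j|`; so one of the two neighbours does at least as well
(`exists_int_rounding`, `exists_grid_excess_ge`). On the typical set, codelength and loss together
are at most `(P / δ + Q δ) ‖θ‖_{w,1} + log 2 / β`, and the hypothesis on `μ₁` says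
`2 √(P Q) ≤ μ₁`, the minimum over `δ` (`exists_mesh`, `column_cost_le`).

Both maxima exist because `d` grows logarithmically and `ℓ` is bounded above, whereas both penalties
grow linearly (`exists_isGreatest_excess_sub`).
-/

namespace RandomDesign

/-! ### Gaussian integrals -/

/-- The weighted geometric mean `p_a^l p_b^(1 - l)` of two Gaussian densities of equal variance,
written as in the Rényi integral, is a multiple of the density with mean `l a + (1 - l) b`. -/
theorem gaussianPDFReal_rpow_mul_rpow (l a b y : ℝ) {v : ℝ≥0} (hv : v ≠ 0) :
    gaussianPDFReal a v y * (gaussianPDFReal b v y / gaussianPDFReal a v y) ^ (1 - l) =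
      Real.exp (-(l * (1 - l) * (b - a) ^ 2 / (2 * v))) *
        gaussianPDFReal (l * a + (1 - l) * b) v y := by
  have hv' : (v : ℝ) ≠ 0 := by exact_mod_cast hv
  have hs : √(2 * Real.pi * v) ≠ 0 := by positivity
  have hq : gaussianPDFReal b v y / gaussianPDFReal a v y =
      Real.exp (-(y - b) ^ 2 / (2 * v) - -(y - a) ^ 2 / (2 * v)) := by
    rw [gaussianPDFReal, gaussianPDFReal, Real.exp_sub]
    field_simp
  rw [hq, ← Real.exp_mul, gaussianPDFReal, gaussianPDFReal, mul_assoc, ← Real.exp_add,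
    mul_left_comm, ← Real.exp_add]
  congr 2
  field_simp
  ring

theorem lintegral_gaussianPDFReal_rpow_mul_rpow (l a b : ℝ) {v : ℝ≥0} (hv : v ≠ 0) :
    ∫⁻ y, ENNReal.ofReal
        (gaussianPDFReal a v y * (gaussianPDFReal b v y / gaussianPDFReal a v y) ^ (1 - l)) =
      ENNReal.ofReal (Real.exp (-(l * (1 - l) * (b - a) ^ 2 / (2 * v)))) := by
  simp_rw [gaussianPDFReal_rpow_mul_rpow l a b _ hv, ENNReal.ofReal_mul (Real.exp_nonneg _)]
  rw [lintegral_const_mul _ (by fun_prop), lintegral_gaussianPDFReal_eq_one _ hv, mul_one]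

theorem integral_exp_neg_mul_sq_gaussianReal {c : ℝ} (hc : 0 ≤ c) (s : ℝ≥0) :
    ∫ z, Real.exp (-(c * z ^ 2 / 2)) ∂(gaussianReal 0 s) = (√(1 + c * s))⁻¹ := by
  by_cases hs : s = 0
  · simp [hs]
  have hs' : (0 : ℝ) < s := by exact_mod_cast pos_iff_ne_zero.2 hs
  rw [integral_gaussianReal_eq_integral_smul hs]
  have h : ∀ z : ℝ, gaussianPDFReal 0 s z • Real.exp (-(c * z ^ 2 / 2)) =
      (√(2 * Real.pi * s))⁻¹ * Real.exp (-((1 + c * s) / (2 * s)) * z ^ 2) := by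
    intro z
    rw [gaussianPDFReal, smul_eq_mul, mul_assoc, ← Real.exp_add]
    congr 2
    field_simp
    ring
  simp_rw [h]
  rw [integral_const_mul, integral_gaussian, ← Real.sqrt_inv, ← Real.sqrt_inv,
    ← Real.sqrt_mul (by positivity)]
  congr 1
  field_simp

open scoped MatrixOrder in
/-- The square root of the covariance matrix `S`, as an operator on Euclidean space; the quadratic
form of `S` is then the squared norm `‖sqrtCov S v‖²`. -/
noncomputable def sqrtCov {p : ℕ} (S : Matrix (Fin p) (Fin p) ℝ) :
    EuclideanSpace ℝ (Fin p) →L[ℝ] EuclideanSpace ℝ (Fin p) :=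
  Matrix.toEuclideanCLM (𝕜 := ℝ) (CFC.sqrt S)

open scoped Matrix MatrixOrder in
theorem norm_sqrtCov_sq {p : ℕ} {S : Matrix (Fin p) (Fin p) ℝ} (hS : S.PosSemidef)
    (v : EuclideanSpace ℝ (Fin p)) : ‖sqrtCov S v‖ ^ 2 = v ⬝ᵥ S *ᵥ v := by
  rw [← real_inner_self_eq_norm_sq, sqrtCov, ← ContinuousLinearMap.adjoint_inner_left,
    IsSelfAdjoint.adjoint_eq, ← ContinuousLinearMap.comp_apply, ← ContinuousLinearMap.mul_def,
    ← map_mul, CFC.sqrt_mul_sqrt_self _ hS.nonneg, real_inner_comm, Matrix.inner_toEuclideanCLM]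
  exact (CFC.sqrt_nonneg S).isSelfAdjoint.map _

theorem multivariateGaussian_map_inner {p : ℕ} {S : Matrix (Fin p) (Fin p) ℝ} (hS : S.PosSemidef)
    (v : EuclideanSpace ℝ (Fin p)) :
    (multivariateGaussian 0 S).map (fun x => inner ℝ x v) =
      gaussianReal 0 (‖sqrtCov S v‖ ^ 2).toNNReal := by
  have hL : (fun x : EuclideanSpace ℝ (Fin p) => inner ℝ x v) = ⇑(innerSL ℝ v) := by
    ext x
    simp [real_inner_comm]
  have hvar : Var[innerSL ℝ v; multivariateGaussian 0 S] = ‖sqrtCov S v‖ ^ 2 := by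
    rw [norm_sqrtCov_sq hS, ← covarianceBilin_multivariateGaussian (μ := 0) hS,
      covarianceBilin_self IsGaussian.memLp_two_id]
    simp
  rw [hL, IsGaussian.map_eq_gaussianReal, hvar,
    ContinuousLinearMap.integral_comp_id_comm IsGaussian.integrable_id,
    integral_id_multivariateGaussian, map_zero]

/-! ### Rényi divergence and likelihood ratio of the regression model -/

theorem measurable_linRegDensity {n p : ℕ} (σ : ℝ) (θ : EuclideanSpace ℝ (Fin p)) :
    Measurable fun z : (Fin n → EuclideanSpace ℝ (Fin p)) × (Fin n → ℝ) =>
      linRegDensity σ θ z.1 z.2 := by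
  unfold linRegDensity gaussianPDFReal
  fun_prop

theorem linRegDensity_pos {n p : ℕ} {σ : ℝ} (hσ : 0 < σ) (θ : EuclideanSpace ℝ (Fin p))
    (x : Fin n → EuclideanSpace ℝ (Fin p)) (y : Fin n → ℝ) : 0 < linRegDensity σ θ x y :=
  Finset.prod_pos fun _ _ => gaussianPDFReal_pos _ _ _ (by simpa using hσ.ne')

/-- Tonelli's theorem for a product of functions of one coordinate each. -/
theorem lintegral_prod_pi {n : ℕ} {E : Type*} [MeasurableSpace E] (μ : Measure E)
    [SigmaFinite μ] (f : Fin n → E → ℝ≥0∞) (hf : ∀ i, Measurable (f i)) :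
    ∫⁻ x, ∏ i, f i (x i) ∂(Measure.pi fun _ : Fin n => μ) = ∏ i, ∫⁻ t, f i t ∂μ := by
  induction n with
  | zero => simp
  | succ n ih =>
    have hmp := (measurePreserving_piFinSuccAbove (fun _ : Fin (n + 1) => μ) 0).symm
    rw [← hmp.lintegral_comp_emb (MeasurableEquiv.measurableEmbedding _), Fin.prod_univ_succ,
      ← ih (fun i => f i.succ) fun i => hf _]
    simp_rw [MeasurableEquiv.piFinSuccAbove_symm_apply, Fin.insertNthEquiv,
      Fin.prod_univ_succ, Fin.insertNth_zero, Equiv.coe_fn_mk, Fin.cons_succ, Fin.cons_zero]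
    exact lintegral_prod_mul (hf 0).aemeasurable
      (Finset.measurable_fun_prod _ fun i _ => (hf _).comp (measurable_pi_apply i)).aemeasurable

/-- Integrating out each `y_i` leaves `exp (-c ⟨x_i, θ - θ₀⟩² / 2)` with `c = lam (1 - lam) / σ²`, and
`⟨x_i, θ - θ₀⟩` is a centred Gaussian with variance `‖sqrtCov S (θ - θ₀)‖²`. -/
theorem integral_ratio_rpow {n p : ℕ} {S : Matrix (Fin p) (Fin p) ℝ} (hS : S.PosSemidef)
    {σ : ℝ} (hσ : 0 < σ) {lam : ℝ} (h0 : 0 ≤ lam) (h1 : lam ≤ 1)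
    (θ₀ θ : EuclideanSpace ℝ (Fin p)) :
    ∫ z, (linRegDensity σ θ z.1 z.2 / linRegDensity σ θ₀ z.1 z.2) ^ (1 - lam)
        ∂(jointLaw (gaussianDesign n p S) (linRegDensity σ θ₀)) =
      ((√(1 + lam * (1 - lam) / σ ^ 2 * ‖sqrtCov S (θ - θ₀)‖ ^ 2))⁻¹) ^ n := by
  have hσ2 : (σ ^ 2).toNNReal ≠ 0 := by simpa using hσ.ne'
  have hv : ((σ ^ 2).toNNReal : ℝ) = σ ^ 2 := Real.coe_toNNReal _ (by positivity)
  have hm := measurable_linRegDensity (n := n) σ θ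
  have hm₀ := measurable_linRegDensity (n := n) σ θ₀
  have hpos := fun θ x y => linRegDensity_pos (n := n) (p := p) hσ θ x y
  have hc : 0 ≤ lam * (1 - lam) / σ ^ 2 :=
    div_nonneg (mul_nonneg h0 (sub_nonneg.2 h1)) (by positivity)
  rw [integral_eq_lintegral_of_nonneg_ae
    (.of_forall fun z => Real.rpow_nonneg (div_nonneg (hpos _ _ _).le (hpos _ _ _).le) _)
    ((hm.div hm₀).pow_const _).aestronglyMeasurable]
  have key : ∫⁻ z, ENNReal.ofReal
        ((linRegDensity σ θ z.1 z.2 / linRegDensity σ θ₀ z.1 z.2) ^ (1 - lam))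
        ∂(jointLaw (gaussianDesign n p S) (linRegDensity σ θ₀)) =
      ENNReal.ofReal (((√(1 + lam * (1 - lam) / σ ^ 2 * ‖sqrtCov S (θ - θ₀)‖ ^ 2))⁻¹) ^ n) := by
    have hr : Measurable fun z : (Fin n → EuclideanSpace ℝ (Fin p)) × (Fin n → ℝ) =>
        ENNReal.ofReal ((linRegDensity σ θ z.1 z.2 / linRegDensity σ θ₀ z.1 z.2) ^ (1 - lam)) :=
      ((hm.div hm₀).pow_const (1 - lam)).ennreal_ofReal
    rw [jointLaw, lintegral_withDensity_eq_lintegral_mul _ hm₀.ennreal_ofReal hr, gaussianDesign,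
      lintegral_prod _ (hm₀.ennreal_ofReal.mul hr).aemeasurable]
    have hin : ∀ x : Fin n → EuclideanSpace ℝ (Fin p), ∀ y : Fin n → ℝ,
        ENNReal.ofReal (linRegDensity σ θ₀ x y) * ENNReal.ofReal
          ((linRegDensity σ θ x y / linRegDensity σ θ₀ x y) ^ (1 - lam)) =
        ∏ i, ENNReal.ofReal (gaussianPDFReal (inner ℝ (x i) θ₀) (σ ^ 2).toNNReal (y i) *
          (gaussianPDFReal (inner ℝ (x i) θ) (σ ^ 2).toNNReal (y i) /
            gaussianPDFReal (inner ℝ (x i) θ₀) (σ ^ 2).toNNReal (y i)) ^ (1 - lam)) := by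
      intro x y
      rw [← ENNReal.ofReal_mul (hpos _ _ _).le, ← ENNReal.ofReal_prod_of_nonneg
        fun i _ => mul_nonneg (gaussianPDFReal_nonneg _ _ _) (Real.rpow_nonneg
          (div_nonneg (gaussianPDFReal_nonneg _ _ _) (gaussianPDFReal_nonneg _ _ _)) _),
        Finset.prod_mul_distrib, Real.finsetProd_rpow _ _
          fun i _ => div_nonneg (gaussianPDFReal_nonneg _ _ _) (gaussianPDFReal_nonneg _ _ _),
        Finset.prod_div_distrib]
      rfl
    have hout : ∀ x : Fin n → EuclideanSpace ℝ (Fin p),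
        ∫⁻ y : Fin n → ℝ, ENNReal.ofReal (linRegDensity σ θ₀ x y) * ENNReal.ofReal
          ((linRegDensity σ θ x y / linRegDensity σ θ₀ x y) ^ (1 - lam)) =
        ∏ i, ENNReal.ofReal (Real.exp
          (-(lam * (1 - lam) / σ ^ 2 * inner ℝ (x i) (θ - θ₀) ^ 2 / 2))) := by
      intro x
      simp_rw [hin x]
      rw [volume_pi, lintegral_prod_pi _ (fun i t => ENNReal.ofReal
        (gaussianPDFReal (inner ℝ (x i) θ₀) (σ ^ 2).toNNReal t *
          (gaussianPDFReal (inner ℝ (x i) θ) (σ ^ 2).toNNReal t /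
            gaussianPDFReal (inner ℝ (x i) θ₀) (σ ^ 2).toNNReal t) ^ (1 - lam)))
        (fun i => by fun_prop)]
      refine Finset.prod_congr rfl fun i _ => ?_
      rw [lintegral_gaussianPDFReal_rpow_mul_rpow _ _ _ hσ2, hv, inner_sub_right]
      congr 3
      field_simp
    simp only [Pi.mul_apply]
    simp_rw [hout]
    rw [lintegral_prod_pi _ (fun _ t => ENNReal.ofReal (Real.exp
          (-(lam * (1 - lam) / σ ^ 2 * inner ℝ t (θ - θ₀) ^ 2 / 2)))) (fun i => by fun_prop)]
    rw [Finset.prod_const, Finset.card_univ, Fintype.card_fin, ENNReal.ofReal_pow (by positivity)]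
    congr 1
    have h2 := integral_exp_neg_mul_sq_gaussianReal hc (‖sqrtCov S (θ - θ₀)‖ ^ 2).toNNReal
    rw [Real.coe_toNNReal _ (by positivity)] at h2
    rw [← h2, ofReal_integral_eq_lintegral_ofReal _ (.of_forall fun _ => Real.exp_nonneg _),
      ← multivariateGaussian_map_inner hS, lintegral_map (by fun_prop) (by fun_prop)]
    refine Integrable.of_bound (by fun_prop) 1 (.of_forall fun z => ?_)
    rw [Real.norm_of_nonneg (Real.exp_nonneg _), Real.exp_le_one_iff, neg_nonpos]
    positivity
  rw [key, ENNReal.toReal_ofReal (by positivity)]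

theorem renyiDiv_linReg {n p : ℕ} {S : Matrix (Fin p) (Fin p) ℝ} (hS : S.PosSemidef)
    {σ : ℝ} (hσ : 0 < σ) {lam : ℝ} (h0 : 0 ≤ lam) (h1 : lam ≤ 1)
    (θ₀ θ : EuclideanSpace ℝ (Fin p)) :
    renyiDiv lam (gaussianDesign n p S) (linRegDensity σ θ₀) (linRegDensity σ θ) =
      n / (2 * (1 - lam)) *
        Real.log (1 + lam * (1 - lam) / σ ^ 2 * ‖sqrtCov S (θ - θ₀)‖ ^ 2) := by
  have hc : 0 ≤ lam * (1 - lam) / σ ^ 2 :=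
    div_nonneg (mul_nonneg h0 (sub_nonneg.2 h1)) (by positivity)
  rw [renyiDiv, integral_ratio_rpow hS hσ h0 h1, Real.log_pow, Real.log_inv,
    Real.log_sqrt (by positivity), div_mul_eq_div_div]
  ring

theorem log_linRegDensity_div {n p : ℕ} {σ : ℝ} (hσ : 0 < σ) (θ₀ θ : EuclideanSpace ℝ (Fin p))
    (x : Fin n → EuclideanSpace ℝ (Fin p)) (y : Fin n → ℝ) :
    Real.log (linRegDensity σ θ₀ x y / linRegDensity σ θ x y) =
      (∑ i, (y i - inner ℝ (x i) θ) ^ 2 - ∑ i, (y i - inner ℝ (x i) θ₀) ^ 2) / (2 * σ ^ 2) := by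
  have hv : ((σ ^ 2).toNNReal : ℝ) = σ ^ 2 := Real.coe_toNNReal _ (by positivity)
  have h : linRegDensity σ θ₀ x y / linRegDensity σ θ x y = Real.exp
      ((∑ i, (y i - inner ℝ (x i) θ) ^ 2 - ∑ i, (y i - inner ℝ (x i) θ₀) ^ 2) / (2 * σ ^ 2)) := by
    rw [linRegDensity, linRegDensity, ← Finset.prod_div_distrib, ← Finset.sum_sub_distrib,
      Finset.sum_div, Real.exp_sum]
    refine Finset.prod_congr rfl fun i _ => ?_
    have hs : √(2 * Real.pi * σ ^ 2) ≠ 0 := by positivity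
    rw [gaussianPDFReal, gaussianPDFReal, hv, mul_div_mul_left _ _ (inv_ne_zero hs),
      ← Real.exp_sub]
    congr 1
    ring
  rw [h, Real.log_exp]

/-! ### Convexity up to a quadratic, and rounding to a grid -/

/-- The second derivative is `(r² - 3)² / (4 (1 + r²)²)`. The constant `1 / 8` is optimal. -/
theorem convexOn_log_one_add_sq_add :
    ConvexOn ℝ Set.univ fun r : ℝ => Real.log (1 + r ^ 2) + r ^ 2 / 8 := by
  have hd : ∀ r : ℝ, HasDerivAt (fun r : ℝ => Real.log (1 + r ^ 2) + r ^ 2 / 8)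
      (2 * r / (1 + r ^ 2) + r / 4) r := by
    intro r
    have h1 : HasDerivAt (fun r : ℝ => 1 + r ^ 2) (2 * r) r := by
      simpa using (hasDerivAt_pow 2 r).const_add 1
    have h2 : HasDerivAt (fun r : ℝ => r ^ 2 / 8) (r / 4) r := by
      refine ((hasDerivAt_pow 2 r).div_const 8).congr_deriv ?_
      norm_num
      ring
    exact (h1.log (by positivity)).add h2
  refine MonotoneOn.convexOn_of_deriv convex_univ
    (fun r _ => (hd r).continuousAt.continuousWithinAt)
    (fun r _ => (hd r).differentiableAt.differentiableWithinAt) ?_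
  intro r _ s _ hrs
  rw [(hd r).deriv, (hd s).deriv, ← sub_nonneg]
  have h : 2 * s / (1 + s ^ 2) + s / 4 - (2 * r / (1 + r ^ 2) + r / 4) =
      (s - r) * ((r - s) ^ 2 + (r * s - 3) ^ 2) / (4 * (1 + r ^ 2) * (1 + s ^ 2)) := by
    field_simp
    ring
  rw [h]
  have := sub_nonneg.2 hrs
  positivity

theorem norm_sq_combo {E : Type*} [NormedAddCommGroup E] [InnerProductSpace ℝ E]
    (a b : E) (f : ℝ) :
    ‖(1 - f) • a + f • b‖ ^ 2 =
      (1 - f) * ‖a‖ ^ 2 + f * ‖b‖ ^ 2 - f * (1 - f) * ‖b - a‖ ^ 2 := by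
  rw [norm_add_sq_real, norm_sub_sq_real, norm_smul, norm_smul, mul_pow, mul_pow,
    real_inner_smul_left, real_inner_smul_right, real_inner_comm a b, Real.norm_eq_abs,
    Real.norm_eq_abs, sq_abs, sq_abs]
  ring

/-- The Hessian of `v ↦ log (1 + ‖v‖²)` is at least `-1 / 4`, stated as convexity up to the quadratic
`‖v‖² / 8`. -/
theorem log_one_add_norm_sq_combo_le {E : Type*} [NormedAddCommGroup E] [InnerProductSpace ℝ E]
    (a b : E) {f : ℝ} (h0 : 0 ≤ f) (h1 : f ≤ 1) :
    Real.log (1 + ‖(1 - f) • a + f • b‖ ^ 2) ≤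
      (1 - f) * Real.log (1 + ‖a‖ ^ 2) + f * Real.log (1 + ‖b‖ ^ 2) +
        f * (1 - f) * (‖b - a‖ ^ 2 / 8) := by
  have hn : ‖(1 - f) • a + f • b‖ ≤ (1 - f) * ‖a‖ + f * ‖b‖ := by
    refine (norm_add_le _ _).trans_eq ?_
    rw [norm_smul, norm_smul, Real.norm_of_nonneg h0, Real.norm_of_nonneg (sub_nonneg.2 h1)]
  have hm : Real.log (1 + ‖(1 - f) • a + f • b‖ ^ 2) + ‖(1 - f) • a + f • b‖ ^ 2 / 8 ≤
      Real.log (1 + ((1 - f) * ‖a‖ + f * ‖b‖) ^ 2) + ((1 - f) * ‖a‖ + f * ‖b‖) ^ 2 / 8 := by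
    gcongr
  have hc := convexOn_log_one_add_sq_add.2 (Set.mem_univ ‖a‖) (Set.mem_univ ‖b‖)
    (sub_nonneg.2 h1) h0 (sub_add_cancel 1 f)
  simp only [smul_eq_mul] at hc
  have hq := norm_sq_combo a b f
  nlinarith

/-- Rounding of one real variable to the grid `d ℤ`. If `φ` is convex up to the quadratic `a t²`,
one of the two grid points around `t` loses at most `a d |t|`, even after the `ℓ¹` term `k |t|`
is charged on both sides. -/
theorem exists_int_rounding {φ : ℝ → ℝ} {a d k : ℝ} (ha : 0 ≤ a) (hd : 0 < d)
    (hφ : ∀ s t f : ℝ, 0 ≤ f → f ≤ 1 →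
      φ ((1 - f) * s + f * t) ≤ (1 - f) * φ s + f * φ t + f * (1 - f) * (a * (t - s) ^ 2))
    (t : ℝ) : ∃ u : ℤ, φ t - (k + a * d) * |t| ≤ φ (d * u) - k * |d * u| := by
  set u : ℤ := ⌊t / d⌋ with hu
  set f : ℝ := Int.fract (t / d) with hf
  have hf0 : 0 ≤ f := Int.fract_nonneg _
  have hf1 : f ≤ 1 := (Int.fract_lt_one _).le
  have htd : t = d * (u + f) := by
    rw [hu, hf, Int.floor_add_fract]
    field_simp
  have ht : t = (1 - f) * (d * u) + f * (d * (u + 1 : ℤ)) := by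
    rw [htd]
    push_cast
    ring
  -- `|·|` is affine on the cell `[d u, d (u + 1)]`, and the variance of the randomized rounding,
  -- `d² f (1 - f)`, is at most `d |t|`.
  have habs : |t| = (1 - f) * |d * u| + f * |d * (u + 1 : ℤ)| ∧ f * (1 - f) * d ≤ |t| := by
    rcases le_or_gt 0 u with h | h
    · have hu0 : (0 : ℝ) ≤ u := by exact_mod_cast h
      have ht0 : 0 ≤ t := by rw [htd]; positivity
      rw [abs_of_nonneg ht0, abs_of_nonneg (by positivity : 0 ≤ d * (u : ℝ)),
        abs_of_nonneg (by push_cast; positivity : 0 ≤ d * ((u + 1 : ℤ) : ℝ))]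
      refine ⟨ht, ?_⟩
      rw [htd]
      nlinarith [mul_nonneg hd.le hu0, mul_nonneg hd.le (mul_nonneg hf0 hf0)]
    · have hu1 : ((u + 1 : ℤ) : ℝ) ≤ 0 := by exact_mod_cast h
      have hu0 : (u : ℝ) ≤ 0 := by push_cast at hu1; linarith
      have hu1' : (u : ℝ) + 1 ≤ 0 := by exact_mod_cast hu1
      have ht0 : t ≤ 0 := by
        rw [htd]
        exact mul_nonpos_of_nonneg_of_nonpos hd.le (by linarith)
      rw [abs_of_nonpos ht0, abs_of_nonpos (mul_nonpos_of_nonneg_of_nonpos hd.le hu0),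
        abs_of_nonpos (mul_nonpos_of_nonneg_of_nonpos hd.le hu1)]
      refine ⟨by linarith, ?_⟩
      rw [htd]
      nlinarith [mul_nonneg hd.le (neg_nonneg.2 hu1'),
        mul_nonneg hd.le (mul_nonneg (sub_nonneg.2 hf1) (sub_nonneg.2 hf1))]
  have hconv := hφ (d * u) (d * (u + 1 : ℤ)) f hf0 hf1
  rw [← ht] at hconv
  have hstep : d * ((u + 1 : ℤ) : ℝ) - d * u = d := by
    push_cast
    ring
  rw [hstep] at hconv
  -- The average of the two neighbours, with weights `1 - f` and `f`, already satisfies the bound.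
  have hvar : f * (1 - f) * (a * d ^ 2) ≤ a * d * |t| := by
    have := mul_le_mul_of_nonneg_left habs.2 (mul_nonneg ha hd.le)
    linarith
  by_contra! hcon
  have h1 := mul_le_mul_of_nonneg_left (hcon u).le (sub_nonneg.2 hf1)
  have h2 := mul_le_mul_of_nonneg_left (hcon (u + 1)).le hf0
  have hk := congrArg (k * ·) habs.1
  beta_reduce at hk
  -- For `f = 0` only the left neighbour has positive weight.
  rcases hf0.eq_or_lt with h | h
  · have := hcon u
    rw [← h] at hconv hk hvar
    linarith
  · have := mul_lt_mul_of_pos_left (hcon (u + 1)) h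
    linarith

/-- Rounding of all coordinates to the grid `∏ j, d j ℤ`, one after the other. -/
theorem exists_lattice_rounding {ι : Type*} [Fintype ι] [DecidableEq ι] {F : (ι → ℝ) → ℝ}
    {a d k : ι → ℝ} (ha : ∀ j, 0 ≤ a j) (hd : ∀ j, 0 < d j)
    (hF : ∀ (θ : ι → ℝ) (j : ι) (s t f : ℝ), 0 ≤ f → f ≤ 1 →
      F (Function.update θ j ((1 - f) * s + f * t)) ≤
        (1 - f) * F (Function.update θ j s) + f * F (Function.update θ j t) +
          f * (1 - f) * (a j * (t - s) ^ 2))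
    (θ : ι → ℝ) : ∃ u : ι → ℤ, F θ - ∑ j, (k j + a j * d j) * |θ j| ≤
      F (fun j => d j * u j) - ∑ j, k j * |d j * u j| := by
  have main : ∀ s : Finset ι, ∃ u : ι → ℤ, F θ - ∑ j ∈ s, (k j + a j * d j) * |θ j| ≤
      F (fun j => if j ∈ s then d j * u j else θ j) - ∑ j ∈ s, k j * |d j * u j| := by
    intro s
    induction s using Finset.induction_on with
    | empty => exact ⟨0, by simp⟩
    | insert i s hi ih =>
      obtain ⟨u, hu⟩ := ih
      obtain ⟨z, hz⟩ := exists_int_rounding (k := k i)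
        (φ := fun t => F (Function.update (fun j => if j ∈ s then d j * u j else θ j) i t)) (ha i) (hd i)
        (hF (fun j => if j ∈ s then d j * u j else θ j) i) (θ i)
      refine ⟨Function.update u i z, ?_⟩
      have e1 : Function.update (fun j => if j ∈ s then d j * u j else θ j) i (θ i) =
          fun j => if j ∈ s then d j * u j else θ j := by
        rw [Function.update_eq_self_iff]
        simp [hi]
      have e2 : Function.update (fun j => if j ∈ s then d j * u j else θ j) i (d i * z) =
          fun j => if j ∈ insert i s then d j * (Function.update u i z j : ℤ) else θ j := by
        funext j
        by_cases h : j = i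
        · subst h
          simp
        · simp [h]
      have e3 : ∑ j ∈ s, k j * |d j * (Function.update u i z j : ℤ)| =
          ∑ j ∈ s, k j * |d j * u j| :=
        Finset.sum_congr rfl fun j hj => by
          rw [Function.update_of_ne (ne_of_mem_of_not_mem hj hi)]
      rw [e1, e2] at hz
      rw [Finset.sum_insert hi, Finset.sum_insert hi, e3, Function.update_self]
      linarith
  obtain ⟨u, hu⟩ := main Finset.univ
  exact ⟨u, by simpa using hu⟩

/-! ### The codelength -/

theorem tsum_pi_prod (n : ℕ) (g : ℤ → ℝ≥0∞) :
    ∑' u : Fin n → ℤ, ∏ j, g (u j) = (∑' z, g z) ^ n := by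
  induction n with
  | zero => simp
  | succ n ih =>
    rw [← (Fin.consEquiv fun _ : Fin (n + 1) => ℤ).tsum_eq, ENNReal.tsum_prod', pow_succ', ← ih]
    simp [Fin.prod_univ_succ, Fin.consEquiv, ENNReal.tsum_mul_left, ENNReal.tsum_mul_right]

theorem tsum_int_pow_natAbs {r : ℝ} (h0 : 0 ≤ r) (h1 : r < 1) :
    ∑' z : ℤ, ENNReal.ofReal (r ^ z.natAbs) = ENNReal.ofReal ((1 + r) / (1 - r)) := by
  have hg := hasSum_geometric_of_lt_one h0 h1
  have hs : HasSum (fun z : ℤ => r ^ z.natAbs) ((1 - r)⁻¹ + r * (1 - r)⁻¹) := by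
    refine HasSum.of_nat_of_neg_add_one (by simpa using hg) ?_
    refine (hg.mul_left r).congr_fun fun n => ?_
    rw [show (-((n : ℤ) + 1)).natAbs = n + 1 by omega, pow_succ']
  rw [← ENNReal.ofReal_tsum_of_nonneg (fun _ => by positivity) hs.summable, hs.tsum_eq]
  congr 1
  field_simp

/-- The ratio is `1 + 2 / (4 p - 1) ≤ 1 + 2 / (3 p)`, so its `p`-th power is at most
`exp (2 / 3) < 2`. -/
theorem ratio_pow_le_two {p : ℕ} (hp : 0 < p) :
    ((1 + 1 / (4 * p : ℝ)) / (1 - 1 / (4 * p : ℝ))) ^ p ≤ 2 := by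
  have hp1 : (1 : ℝ) ≤ p := by exact_mod_cast hp
  have h4 : (0 : ℝ) < 4 * p - 1 := by linarith
  have h : (1 + 1 / (4 * p : ℝ)) / (1 - 1 / (4 * p : ℝ)) ≤ Real.exp (2 / 3 / p) := by
    refine le_trans ?_ (Real.add_one_le_exp _)
    have e : (1 + 1 / (4 * p : ℝ)) / (1 - 1 / (4 * p : ℝ)) = 2 / (4 * p - 1) + 1 := by
      have : (p : ℝ) * 4 - 1 ≠ 0 := by linarith
      field_simp
      ring
    rw [e, add_le_add_iff_right, div_div, div_le_div_iff₀ h4 (by positivity)]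
    linarith
  calc _ ≤ Real.exp (2 / 3 / p) ^ p := by
        gcongr
        refine div_nonneg (by positivity) ?_
        rw [sub_nonneg, div_le_one (by positivity)]
        linarith
    _ = Real.exp (2 / 3) := by
        rw [← Real.exp_nat_mul]
        congr 1
        field_simp
    _ ≤ Real.exp (Real.log 2) := Real.exp_le_exp.2 (by linarith [Real.log_two_gt_d9])
    _ = 2 := Real.exp_log two_pos

/-- The grid `∏ j, d j ℤ` in Euclidean space. -/
def grid {p : ℕ} (d : Fin p → ℝ) : Set (EuclideanSpace ℝ (Fin p)) :=
  Set.range fun u : Fin p → ℤ => WithLp.toLp 2 fun j => d j * u j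

theorem isClosed_grid {p : ℕ} {d : Fin p → ℝ} (hd : ∀ j, d j ≠ 0) : IsClosed (grid d) := by
  have h : grid d = ⋂ j, (fun θ : EuclideanSpace ℝ (Fin p) => θ j / d j) ⁻¹'
      Set.range ((↑) : ℤ → ℝ) := by
    ext θ
    simp only [grid, Set.mem_range, Set.mem_iInter, Set.mem_preimage]
    constructor
    · rintro ⟨u, rfl⟩ j
      exact ⟨u j, by simp [hd j]⟩
    · intro h
      choose u hu using h
      refine ⟨u, ?_⟩
      ext j
      simp [hu, mul_div_cancel₀ _ (hd j)]
  rw [h]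
  exact isClosed_iInter fun j => Int.isClosedEmbedding_coe_real.isClosed_range.preimage
    (by fun_prop)

/-- Each coordinate `d j u` of a grid point costs `|u| log (4 p) / β`, and the whole word
`log 2 / β` on top; the sum of the weights is
`((1 + 1 / (4 p)) / (1 - 1 / (4 p))) ^ p / 2 ≤ 1`. -/
theorem strongKraft_grid {p : ℕ} (hp : 0 < p) {β : ℝ} (hβ : β ≠ 0) {d k : Fin p → ℝ}
    (hd : ∀ j, 0 < d j) (hk : ∀ j, k j * d j = Real.log (4 * p) / β) :
    StrongKraft β (grid d) fun θ => ∑ j, k j * |θ j| + Real.log 2 / β := by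
  have hp1 : (1 : ℝ) ≤ p := by exact_mod_cast hp
  have hinj : Function.Injective
      fun u : Fin p → ℤ => (WithLp.toLp 2 fun j => d j * u j : EuclideanSpace ℝ (Fin p)) := by
    intro u v h
    funext j
    have := congrArg (fun θ : EuclideanSpace ℝ (Fin p) => θ j) h
    simpa [(hd j).ne'] using this
  rw [StrongKraft, grid, tsum_range (fun θ : EuclideanSpace ℝ (Fin p) => ENNReal.ofReal
    (Real.exp (-(β * (∑ j, k j * |θ j| + Real.log 2 / β))))) hinj]
  have hterm : ∀ u : Fin p → ℤ, ENNReal.ofReal (Real.exp (-(β * (∑ j, k j *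
      |(WithLp.toLp 2 fun j => d j * u j : EuclideanSpace ℝ (Fin p)) j| + Real.log 2 / β)))) =
      ENNReal.ofReal (1 / 2) * ∏ j, ENNReal.ofReal ((1 / (4 * p : ℝ)) ^ (u j).natAbs) := by
    intro u
    rw [← ENNReal.ofReal_prod_of_nonneg fun _ _ => by positivity,
      ← ENNReal.ofReal_mul (by positivity)]
    congr 1
    have h1 : ∀ j, (1 / (4 * p : ℝ)) ^ (u j).natAbs =
        Real.exp (-(β * (k j * |d j * u j|))) := by
      intro j
      rw [abs_mul, abs_of_pos (hd j), ← mul_assoc (k j), hk j, ← mul_assoc,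
        mul_div_cancel₀ _ hβ, ← Int.cast_abs, Int.abs_eq_natAbs, Int.cast_natCast,
        one_div, ← Real.exp_log (by positivity : (0 : ℝ) < 4 * p), ← Real.exp_neg,
        ← Real.exp_nat_mul, Real.log_exp]
      congr 1
      ring
    have h2 : (1 / 2 : ℝ) = Real.exp (-Real.log 2) := by
      rw [Real.exp_neg, Real.exp_log two_pos, one_div]
    simp_rw [h1]
    rw [h2, ← Real.exp_sum, ← Real.exp_add, Finset.sum_neg_distrib, ← Finset.mul_sum, mul_add,
      mul_div_cancel₀ _ hβ]
    congr 1
    ring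
  have hr : 1 / (4 * p : ℝ) < 1 := by
    rw [div_lt_one (by positivity)]
    linarith
  simp_rw [hterm]
  rw [ENNReal.tsum_mul_left, tsum_pi_prod p fun z => ENNReal.ofReal ((1 / (4 * p : ℝ)) ^ z.natAbs),
    tsum_int_pow_natAbs (by positivity) hr,
    ← ENNReal.ofReal_pow (div_nonneg (by positivity) (sub_nonneg.2 hr.le)),
    ← ENNReal.ofReal_mul (by positivity), ENNReal.ofReal_le_one]
  linarith [ratio_pow_le_two hp]

/-! ### The excess of the regression model -/

/-- The value `d^n_lam(p_*, p_θ) - log (p_*(yⁿ|xⁿ) / p_θ(yⁿ|xⁿ))` in closed form, with covariance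
`S` of the design and true parameter `θ₀`. -/
noncomputable def excess {n p : ℕ} (lam σ : ℝ) (S : Matrix (Fin p) (Fin p) ℝ)
    (θ₀ : EuclideanSpace ℝ (Fin p)) (x : Fin n → EuclideanSpace ℝ (Fin p)) (y : Fin n → ℝ)
    (θ : EuclideanSpace ℝ (Fin p)) : ℝ :=
  n / (2 * (1 - lam)) * Real.log (1 + lam * (1 - lam) / σ ^ 2 * ‖sqrtCov S (θ - θ₀)‖ ^ 2) -
    (∑ i, (y i - inner ℝ (x i) θ) ^ 2 - ∑ i, (y i - inner ℝ (x i) θ₀) ^ 2) / (2 * σ ^ 2)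

variable {n p : ℕ} {lam σ : ℝ} {S : Matrix (Fin p) (Fin p) ℝ}

theorem penalizedExcess_linReg (hS : S.PosSemidef) (hσ : 0 < σ) (h0 : 0 ≤ lam) (h1 : lam ≤ 1)
    (θ₀ θ : EuclideanSpace ℝ (Fin p)) (ℓ : ℝ) (x : Fin n → EuclideanSpace ℝ (Fin p))
    (y : Fin n → ℝ) :
    penalizedExcess lam (gaussianDesign n p S) (linRegDensity σ θ₀) (linRegDensity σ θ) ℓ x y =
      excess lam σ S θ₀ x y θ - ℓ := by
  rw [penalizedExcess, renyiDiv_linReg hS hσ h0 h1, log_linRegDensity_div hσ, excess]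

theorem continuous_excess (h0 : 0 ≤ lam) (h1 : lam ≤ 1) (θ₀ : EuclideanSpace ℝ (Fin p))
    (x : Fin n → EuclideanSpace ℝ (Fin p)) (y : Fin n → ℝ) :
    Continuous (excess lam σ S θ₀ x y) := by
  have hc : 0 ≤ lam * (1 - lam) / σ ^ 2 :=
    div_nonneg (mul_nonneg h0 (sub_nonneg.2 h1)) (by positivity)
  unfold excess
  refine Continuous.sub (continuous_const.mul (Continuous.log (by fun_prop) fun θ => ?_))
    (by fun_prop)
  positivity

/-- The excess is convex up to a quadratic form: the divergence term contributes
`n lam / (16 σ²)` times the covariance form, the log-likelihood its own quadratic part. -/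
theorem excess_combo_le (hσ : 0 < σ) (h0 : 0 ≤ lam) (h1 : lam < 1)
    (θ₀ : EuclideanSpace ℝ (Fin p)) (x : Fin n → EuclideanSpace ℝ (Fin p)) (y : Fin n → ℝ)
    (a b : EuclideanSpace ℝ (Fin p)) {f : ℝ} (hf0 : 0 ≤ f) (hf1 : f ≤ 1) :
    excess lam σ S θ₀ x y ((1 - f) • a + f • b) ≤
      (1 - f) * excess lam σ S θ₀ x y a + f * excess lam σ S θ₀ x y b +
        f * (1 - f) * (n * lam / (16 * σ ^ 2) * ‖sqrtCov S (b - a)‖ ^ 2 +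
          (∑ i, inner ℝ (x i) (b - a) ^ 2) / (2 * σ ^ 2)) := by
  have hl : 0 < 1 - lam := sub_pos.2 h1
  have hc : 0 ≤ lam * (1 - lam) / σ ^ 2 := by positivity
  set c := lam * (1 - lam) / σ ^ 2 with hcdef
  set B : EuclideanSpace ℝ (Fin p) →L[ℝ] EuclideanSpace ℝ (Fin p) := √c • sqrtCov S with hB
  have hBn : ∀ v, c * ‖sqrtCov S v‖ ^ 2 = ‖B v‖ ^ 2 := by
    intro v
    rw [hB, smul_apply, norm_smul, mul_pow, Real.norm_eq_abs, sq_abs,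
      Real.sq_sqrt hc]
  have hlog := log_one_add_norm_sq_combo_le (B (a - θ₀)) (B (b - θ₀)) hf0 hf1
  rw [← map_smul, ← map_smul, ← map_add, ← map_sub, sub_sub_sub_cancel_right,
    show (1 - f) • (a - θ₀) + f • (b - θ₀) = (1 - f) • a + f • b - θ₀ by module] at hlog
  have hK : (n : ℝ) / (2 * (1 - lam)) * (‖B (b - a)‖ ^ 2 / 8) =
      n * lam / (16 * σ ^ 2) * ‖sqrtCov S (b - a)‖ ^ 2 := by
    rw [← hBn, hcdef]
    field_simp
    ring
  have hlog' := mul_le_mul_of_nonneg_left hlog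
    (by positivity : (0 : ℝ) ≤ n / (2 * (1 - lam)))
  have hq : ∑ i, (y i - inner ℝ (x i) ((1 - f) • a + f • b)) ^ 2 =
      (1 - f) * ∑ i, (y i - inner ℝ (x i) a) ^ 2 + f * ∑ i, (y i - inner ℝ (x i) b) ^ 2 -
        f * (1 - f) * ∑ i, inner ℝ (x i) (b - a) ^ 2 := by
    rw [Finset.mul_sum, Finset.mul_sum, Finset.mul_sum, ← Finset.sum_add_distrib,
      ← Finset.sum_sub_distrib]
    refine Finset.sum_congr rfl fun i _ => ?_
    rw [inner_add_right, inner_sub_right, real_inner_smul_right, real_inner_smul_right]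
    ring
  unfold excess
  rw [hBn, hBn, hBn, hq, ← hK]
  refine (sub_le_sub_right hlog' _).trans_eq ?_
  ring

theorem log_one_add_sq_le {η r : ℝ} (hη : 0 < η) (hr : 0 ≤ r) :
    Real.log (1 + r ^ 2) ≤ η * (1 + r) - 2 - 2 * Real.log (η / 2) := by
  have h1 : Real.log (1 + r ^ 2) ≤ 2 * Real.log (1 + r) := by
    rw [← Real.log_rpow (by positivity), Real.rpow_two]
    exact Real.log_le_log (by positivity) (by nlinarith)
  have h2 := Real.log_le_sub_one_of_pos (by positivity : 0 < η / 2 * (1 + r))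
  rw [Real.log_mul (by positivity) (by positivity)] at h2
  linarith

/-- The excess grows slower than any positive multiple of the norm, because the divergence grows
logarithmically and the log-likelihood is bounded above. -/
theorem exists_excess_le (hσ : 0 < σ) (h0 : 0 ≤ lam) (h1 : lam < 1)
    (θ₀ : EuclideanSpace ℝ (Fin p)) (x : Fin n → EuclideanSpace ℝ (Fin p)) (y : Fin n → ℝ)
    {η : ℝ} (hη : 0 < η) : ∃ C, ∀ θ, excess lam σ S θ₀ x y θ ≤ C + η * ‖θ‖ := by
  have hl : 0 < 1 - lam := sub_pos.2 h1
  have hc : 0 ≤ lam * (1 - lam) / σ ^ 2 := by positivity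
  set c := lam * (1 - lam) / σ ^ 2 with hcdef
  set K : ℝ := n / (2 * (1 - lam)) with hK
  have hK0 : 0 ≤ K := by positivity
  set R : ℝ := √c * ‖sqrtCov S‖ with hR
  have hR0 : 0 ≤ R := by positivity
  -- The added `1` keeps the denominator positive when `R = 0`.
  set η' : ℝ := η / (K * R + 1) with hη'
  have hη'0 : 0 < η' := by positivity
  have hle : K * (η' * R) ≤ η := by
    rw [hη', show K * (η / (K * R + 1) * R) = η * (K * R) / (K * R + 1) by ring,
      div_le_iff₀ (by positivity)]
    nlinarith
  refine ⟨K * (η' - 2 - 2 * Real.log (η' / 2)) + η * ‖θ₀‖ +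
    (∑ i, (y i - inner ℝ (x i) θ₀) ^ 2) / (2 * σ ^ 2), fun θ => ?_⟩
  have hr := log_one_add_sq_le hη'0 (by positivity : 0 ≤ √c * ‖sqrtCov S (θ - θ₀)‖)
  rw [mul_pow, Real.sq_sqrt hc] at hr
  have hnorm : √c * ‖sqrtCov S (θ - θ₀)‖ ≤ R * (‖θ‖ + ‖θ₀‖) := by
    rw [hR, mul_assoc]
    gcongr
    exact ((sqrtCov S).le_opNorm _).trans (by gcongr; exact norm_sub_le _ _)
  have h3 : K * (η' * (√c * ‖sqrtCov S (θ - θ₀)‖)) ≤ η * (‖θ‖ + ‖θ₀‖) := by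
    calc _ ≤ K * (η' * (R * (‖θ‖ + ‖θ₀‖))) := by gcongr
      _ = K * (η' * R) * (‖θ‖ + ‖θ₀‖) := by ring
      _ ≤ _ := by gcongr
  have h4 := mul_le_mul_of_nonneg_left hr hK0
  have h5 : 0 ≤ (∑ i, (y i - inner ℝ (x i) θ) ^ 2) / (2 * σ ^ 2) := by positivity
  unfold excess
  rw [sub_div]
  linarith

theorem exists_mul_norm_le_weighted_sum (hp : 0 < p) {g : Fin p → ℝ} (hg : ∀ j, 0 < g j) :
    ∃ m > 0, ∀ θ : EuclideanSpace ℝ (Fin p), m * ‖θ‖ ≤ ∑ j, g j * |θ j| := by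
  have : Nonempty (Fin p) := ⟨⟨0, hp⟩⟩
  obtain ⟨i, hi⟩ := Finite.exists_min g
  refine ⟨g i, hg i, fun θ => ?_⟩
  have hn : ‖θ‖ ≤ ∑ j, |θ j| := by
    rw [EuclideanSpace.norm_eq]
    refine Real.sqrt_le_iff.2 ⟨by positivity, ?_⟩
    simpa using Finset.sum_sq_le_sq_sum_of_nonneg (s := Finset.univ) (f := fun j => |θ j|)
      fun j _ => abs_nonneg _
  calc g i * ‖θ‖ ≤ g i * ∑ j, |θ j| := mul_le_mul_of_nonneg_left hn (hg i).le
    _ = ∑ j, g i * |θ j| := Finset.mul_sum _ _ _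
    _ ≤ _ := Finset.sum_le_sum fun j _ => mul_le_mul_of_nonneg_right (hi j) (abs_nonneg _)

theorem exists_isGreatest_excess_sub (hp : 0 < p) (hσ : 0 < σ) (h0 : 0 ≤ lam) (h1 : lam < 1)
    (θ₀ : EuclideanSpace ℝ (Fin p)) (x : Fin n → EuclideanSpace ℝ (Fin p)) (y : Fin n → ℝ)
    {g : Fin p → ℝ} (hg : ∀ j, 0 < g j) (C : ℝ) {T : Set (EuclideanSpace ℝ (Fin p))}
    (hT : IsClosed T) (hT0 : T.Nonempty) :
    ∃ b, IsGreatest ((fun θ => excess lam σ S θ₀ x y θ - (∑ j, g j * |θ j| + C)) '' T) b := by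
  obtain ⟨m, hm, hmle⟩ := exists_mul_norm_le_weighted_sum hp hg
  obtain ⟨D, hD⟩ := exists_excess_le (S := S) hσ h0 h1 θ₀ x y (half_pos hm)
  obtain ⟨t, ht⟩ := hT0
  have hcont : Continuous fun θ => excess lam σ S θ₀ x y θ - (∑ j, g j * |θ j| + C) :=
    (continuous_excess h0 h1.le θ₀ x y).sub (by fun_prop)
  have hev : ∀ᶠ θ in Filter.cocompact (EuclideanSpace ℝ (Fin p)),
      excess lam σ S θ₀ x y θ - (∑ j, g j * |θ j| + C) ≤
        excess lam σ S θ₀ x y t - (∑ j, g j * |t j| + C) := by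
    filter_upwards [(tendsto_norm_cocompact_atTop (E := EuclideanSpace ℝ (Fin p))).eventually_ge_atTop
      ((D - C - (excess lam σ S θ₀ x y t - (∑ j, g j * |t j| + C))) / (m / 2))] with θ hθ
    rw [div_le_iff₀ (half_pos hm)] at hθ
    linarith [hD θ, hmle θ]
  obtain ⟨b, hb, hmax⟩ := hcont.continuousOn.exists_isMaxOn' hT ht (hev.filter_mono inf_le_left)
  exact ⟨_, ⟨b, hb, rfl⟩, by rintro _ ⟨θ, hθ, rfl⟩; exact hmax hθ⟩

open scoped Matrix in
/-- Rounding to the grid, for the excess: the curvature in direction `j` is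
`n lam S_jj / (16 σ²) + n w_j² / (2 σ²)`, where `w_j² = colMoment x j`. -/
theorem exists_grid_excess_ge (hS : S.PosSemidef) (hn : 0 < n) (hσ : 0 < σ) (h0 : 0 ≤ lam)
    (h1 : lam < 1)
    (θ₀ : EuclideanSpace ℝ (Fin p)) (x : Fin n → EuclideanSpace ℝ (Fin p)) (y : Fin n → ℝ)
    {d : Fin p → ℝ} (hd : ∀ j, 0 < d j) (k : Fin p → ℝ) (θ : EuclideanSpace ℝ (Fin p)) :
    ∃ θ' ∈ grid d, excess lam σ S θ₀ x y θ - ∑ j, (k j + (n * lam / (16 * σ ^ 2) * S j j +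
        n * colMoment x j / (2 * σ ^ 2)) * d j) * |θ j| ≤
      excess lam σ S θ₀ x y θ' - ∑ j, k j * |θ' j| := by
  have hcol : ∀ j, ∑ i, (x i j) ^ 2 = n * colMoment x j := by
    intro j
    have : (n : ℝ) ≠ 0 := by exact_mod_cast hn.ne'
    rw [colMoment]
    field_simp
  have hcov : ∀ j, ‖sqrtCov S (EuclideanSpace.single j 1)‖ ^ 2 = S j j := by
    intro j
    rw [norm_sqrtCov_sq hS]
    simp
  have hnn : ∀ j, 0 ≤ n * lam / (16 * σ ^ 2) * S j j + n * colMoment x j / (2 * σ ^ 2) := by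
    intro j
    rw [← hcol, ← hcov]
    positivity
  have hF : ∀ (v : Fin p → ℝ) (j : Fin p) (s t f : ℝ), 0 ≤ f → f ≤ 1 →
      excess lam σ S θ₀ x y (WithLp.toLp 2 (Function.update v j ((1 - f) * s + f * t))) ≤
        (1 - f) * excess lam σ S θ₀ x y (WithLp.toLp 2 (Function.update v j s)) +
          f * excess lam σ S θ₀ x y (WithLp.toLp 2 (Function.update v j t)) +
          f * (1 - f) * ((n * lam / (16 * σ ^ 2) * S j j +
            n * colMoment x j / (2 * σ ^ 2)) * (t - s) ^ 2) := by
    intro v j s t f hf0 hf1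
    have e1 : (WithLp.toLp 2 (Function.update v j ((1 - f) * s + f * t)) :
        EuclideanSpace ℝ (Fin p)) = (1 - f) • WithLp.toLp 2 (Function.update v j s) +
          f • WithLp.toLp 2 (Function.update v j t) := by
      ext i
      by_cases h : i = j
      · subst h
        simp
      · simp only [PiLp.add_apply, PiLp.smul_apply, Function.update_of_ne h, smul_eq_mul]
        ring
    have e2 : (WithLp.toLp 2 (Function.update v j t) : EuclideanSpace ℝ (Fin p)) -
        WithLp.toLp 2 (Function.update v j s) = (t - s) • EuclideanSpace.single j 1 := by
      ext i
      by_cases h : i = j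
      · subst h
        simp
      · simp [h]
    have h := excess_combo_le (S := S) hσ h0 h1 θ₀ x y (WithLp.toLp 2 (Function.update v j s))
      (WithLp.toLp 2 (Function.update v j t)) hf0 hf1
    rw [← e1, e2, map_smul, norm_smul, mul_pow, hcov, Real.norm_eq_abs, sq_abs] at h
    have e3 : ∑ i, inner ℝ (x i) ((t - s) • EuclideanSpace.single j (1 : ℝ)) ^ 2 =
        (t - s) ^ 2 * (n * colMoment x j) := by
      rw [← hcol, Finset.mul_sum]
      refine Finset.sum_congr rfl fun i _ => ?_
      rw [real_inner_smul_right, EuclideanSpace.inner_single_right]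
      simp [mul_pow]
    rw [e3] at h
    refine h.trans_eq ?_
    ring
  obtain ⟨u, hu⟩ := exists_lattice_rounding
    (F := fun v => excess lam σ S θ₀ x y (WithLp.toLp 2 v)) (k := k) hnn hd hF (fun j => θ j)
  exact ⟨_, ⟨u, rfl⟩, hu⟩

/-! ### Choice of the mesh size -/

theorem exists_pos_div_add_mul_le {P Q μ : ℝ} (hP : 0 < P) (hQ : 0 < Q) (h : √(4 * (P * Q)) ≤ μ) :
    ∃ δ > 0, P / δ + Q * δ ≤ μ := by
  obtain ⟨A, hA, rfl⟩ : ∃ A > 0, A ^ 2 = P := ⟨√P, by positivity, Real.sq_sqrt hP.le⟩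
  obtain ⟨B, hB, rfl⟩ : ∃ B > 0, B ^ 2 = Q := ⟨√Q, by positivity, Real.sq_sqrt hQ.le⟩
  refine ⟨A / B, by positivity, le_trans (le_of_eq ?_) h⟩
  rw [show 4 * (A ^ 2 * B ^ 2) = (2 * (A * B)) ^ 2 by ring, Real.sqrt_sq (by positivity)]
  field_simp
  ring

/-- The mesh size `δ` balances the codelength `log (4 p) / (β δ)` per unit of `ℓ¹` norm against the
rounding loss, which is proportional to `δ`. -/
theorem exists_mesh {p n : ℕ} (hn : 0 < n) (hp : 0 < p) {ε σ β lam μ : ℝ}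
    (hε : ε ∈ Set.Ioo (0 : ℝ) 1) (hσ : 0 < σ) (hβ : 0 < β) (hlam : 0 < lam)
    (hμ : √((n * Real.log (4 * p)) / (β * σ ^ 2 * (1 - ε)) *
      ((lam + 8 * √(1 - ε ^ 2)) / 4)) ≤ μ) :
    ∃ δ > 0, Real.log (4 * p) / (β * √(1 - ε)) / δ +
      n / σ ^ 2 * (lam / (16 * √(1 - ε)) + √(1 + ε) / 2) * δ ≤ μ := by
  have h1 : 0 < 1 - ε := sub_pos.2 hε.2
  have h2 : 0 < 1 + ε := by linarith [hε.1]
  have hp1 : (1 : ℝ) ≤ p := by exact_mod_cast hp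
  have hL : 0 < Real.log (4 * p) := Real.log_pos (by linarith)
  have hn' : (0 : ℝ) < n := by exact_mod_cast hn
  refine exists_pos_div_add_mul_le (by positivity) (by positivity) (le_trans (le_of_eq ?_) hμ)
  congr 1
  have ha : 0 < √(1 - ε) := by positivity
  rw [show 1 - ε ^ 2 = (1 - ε) * (1 + ε) by ring, Real.sqrt_mul h1.le]
  have hsq : 1 - ε = √(1 - ε) ^ 2 := (Real.sq_sqrt h1.le).symm
  rw [show β * σ ^ 2 * (1 - ε) = β * σ ^ 2 * √(1 - ε) ^ 2 by rw [← hsq]]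
  field_simp
  ring

/-- `s = √S_jj` is the population weight of a column and `w` its empirical weight; on the typical
set their ratio lies between `√(1 - ε)` and `√(1 + ε)`. -/
theorem column_cost_le {L β δ N lam σ a b s w μ : ℝ} (hL : 0 ≤ L) (hβ : 0 < β) (hδ : 0 < δ)
    (hN : 0 ≤ N) (hlam : 0 ≤ lam) (hσ : 0 < σ) (ha : 0 < a) (hs : 0 < s) (hw : 0 ≤ w)
    (haw : a * s ≤ w) (hbw : w ≤ b * s)
    (hμ : L / (β * a) / δ + N / σ ^ 2 * (lam / (16 * a) + b / 2) * δ ≤ μ) :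
    L / (β * δ) * s + (N * lam / (16 * σ ^ 2) * s ^ 2 + N * w ^ 2 / (2 * σ ^ 2)) * (δ / s) ≤
      μ * w := by
  have h1 : s ≤ w / a := by rwa [le_div_iff₀ ha, mul_comm]
  have h2 : w / s ≤ b := by rwa [div_le_iff₀ hs]
  calc _ = (L / (β * δ) + N * lam * δ / (16 * σ ^ 2)) * s +
        N * δ / (2 * σ ^ 2) * w * (w / s) := by
        field_simp
        ring
    _ ≤ (L / (β * δ) + N * lam * δ / (16 * σ ^ 2)) * (w / a) +
        N * δ / (2 * σ ^ 2) * w * b := by gcongr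
    _ = (L / (β * a) / δ + N / σ ^ 2 * (lam / (16 * a) + b / 2) * δ) * w := by
        field_simp
        ring
    _ ≤ μ * w := by gcongr

end RandomDesign

theorem lemma1 (n p : ℕ) (hn : 0 < n) (hp : 0 < p)
    (ε : ℝ) (hε : ε ∈ Set.Ioo (0 : ℝ) 1)
    (σ : ℝ) (hσ : 0 < σ) (θstar : EuclideanSpace ℝ (Fin p))
    (β : ℝ) (hβ : β ∈ Set.Ioo (0 : ℝ) 1)
    (lam : ℝ) (hlam : lam ∈ Set.Ioc (0 : ℝ) (1 - β))
    (μ₁ μ₂ : ℝ)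
    (hμ₁ : Real.sqrt ((n * Real.log (4 * p)) / (β * σ ^ 2 * (1 - ε)) *
      ((lam + 8 * Real.sqrt (1 - ε ^ 2)) / 4)) ≤ μ₁)
    (hμ₂ : Real.log 2 / β ≤ μ₂) :
    RandomDesign.IsEpsRiskValid lam β
      (fun S : {S : Matrix (Fin p) (Fin p) ℝ // S.PosDef} =>
        RandomDesign.gaussianDesign n p S.1)
      (fun S => RandomDesign.typicalSet n p ε S.1)
      (RandomDesign.linRegDensity σ θstar)
      (fun θ : EuclideanSpace ℝ (Fin p) => RandomDesign.linRegDensity σ θ)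
      (fun θ x => μ₁ * RandomDesign.weightedL1 x θ + μ₂) := by
  open RandomDesign in
  rintro ⟨S, hS⟩
  have h0 : 0 < lam := hlam.1
  have h1 : lam < 1 := by linarith [hlam.2, hβ.1]
  have hε1 : 0 < 1 - ε := sub_pos.2 hε.2
  have hε2 : 0 < 1 + ε := by linarith [hε.1]
  have hp1 : (1 : ℝ) ≤ p := by exact_mod_cast hp
  have hL : 0 < Real.log (4 * p) := Real.log_pos (by linarith)
  have hn' : (0 : ℝ) < n := by exact_mod_cast hn
  obtain ⟨δ, hδ, hδμ⟩ := exists_mesh hn hp hε hσ hβ.1 h0 hμ₁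
  have hSd : ∀ j, 0 < S j j := fun j => hS.diag_pos
  have hs : ∀ j, 0 < √(S j j) := fun j => Real.sqrt_pos.2 (hSd j)
  set d : Fin p → ℝ := fun j => δ / √(S j j) with hd
  set k : Fin p → ℝ := fun j => Real.log (4 * p) / (β * δ) * √(S j j) with hk
  have hd0 : ∀ j, 0 < d j := fun j => div_pos hδ (hs j)
  have hβ0 := hβ.1
  have hk0 : ∀ j, 0 < k j := fun j => mul_pos (by positivity) (hs j)
  refine ⟨grid d, fun θ => ∑ j, k j * |θ j| + Real.log 2 / β,
    strongKraft_grid hp hβ0.ne' hd0 fun j => ?_, fun x hx y => ?_⟩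
  · have := hs j
    rw [hk, hd]
    field_simp
  -- Strict positivity of `μ₁` and of the column weights makes the penalty coercive.
  have hμ0 : 0 < μ₁ := lt_of_lt_of_le (by positivity) hδμ
  have hlo : ∀ j, (1 - ε) * S j j ≤ colMoment x j := fun j => by
    have := (hx j).1
    rwa [le_div_iff₀ (hSd j)] at this
  have hhi : ∀ j, colMoment x j ≤ (1 + ε) * S j j := fun j => by
    have := (hx j).2
    rwa [div_le_iff₀ (hSd j)] at this
  have hcm : ∀ j, 0 < colMoment x j := fun j => (mul_pos hε1 (hSd j)).trans_le (hlo j)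
  have hpen : ∀ θ : EuclideanSpace ℝ (Fin p),
      μ₁ * weightedL1 x θ + μ₂ = ∑ j, μ₁ * √(colMoment x j) * |θ j| + μ₂ := by
    intro θ
    rw [weightedL1, Finset.mul_sum]
    simp_rw [mul_assoc]
  simp_rw [penalizedExcess_linReg hS.posSemidef hσ h0.le h1.le, hpen]
  obtain ⟨a, ha⟩ := exists_isGreatest_excess_sub (S := S) hp hσ h0.le h1 θstar x y
    (fun j => mul_pos hμ0 (Real.sqrt_pos.2 (hcm j))) μ₂ isClosed_univ Set.univ_nonempty
  obtain ⟨b, hb⟩ := exists_isGreatest_excess_sub (S := S) hp hσ h0.le h1 θstar x y hk0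
    (Real.log 2 / β) (isClosed_grid fun j => (hd0 j).ne') ⟨_, ⟨0, rfl⟩⟩
  rw [Set.image_univ] at ha
  refine ⟨a, b, ha, hb, ?_⟩
  obtain ⟨θ, rfl⟩ := ha.1
  obtain ⟨θ', hθ', hround⟩ := exists_grid_excess_ge hS.posSemidef hn hσ h0.le h1 θstar x y hd0 k θ
  refine le_trans ?_ (hb.2 ⟨θ', hθ', rfl⟩)
  have hcost : ∑ j, (k j + (n * lam / (16 * σ ^ 2) * S j j +
      n * colMoment x j / (2 * σ ^ 2)) * d j) * |θ j| ≤ ∑ j, μ₁ * √(colMoment x j) * |θ j| := by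
    refine Finset.sum_le_sum fun j _ => mul_le_mul_of_nonneg_right ?_ (abs_nonneg _)
    have h := column_cost_le hL.le hβ0 hδ hn'.le h0.le hσ (Real.sqrt_pos.2 hε1) (hs j)
      (Real.sqrt_nonneg (colMoment x j))
      (by rw [← Real.sqrt_mul hε1.le]; exact Real.sqrt_le_sqrt (hlo j))
      (by rw [← Real.sqrt_mul hε2.le]; exact Real.sqrt_le_sqrt (hhi j)) hδμ
    rwa [Real.sq_sqrt (hSd j).le, Real.sq_sqrt (hcm j).le] at h
  beta_reduce
  linarith
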